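/- Let $\mathcal X,\hat{\mathcal X}_1,\hat{\mathcal X}_2,\mathcal Z$ be finite alphabets, let $X_1,X_2,\dots$ be i.i.d. with law $P_X$ on $\mathcal X$, let $d_i:\mathcal X\times\hat{\mathcal X}_i\to[0,\infty)$ ($i=1,2$) be distortion measures, extended to words by $d_i(x^n,\hat x^n)=\frac1n\sum_{j=1}^n d_i(x_j,\hat x_j)$, and let $g:\hat{\mathcal X}_1\to\mathcal Z$ be the crib function. Fix one of three kinds of cribbing: non-causal ($d(i)=n$), strictly-causal ($d(i)=i-1$) or causal ($d(i)=i$). All rates are nonnegative, and $\{1,\dots,2^{nR}\}$ is the set of integers $k$ with $1\le k\le 2^{nR}$. A $(2^{nR_0},2^{nR_1},n)$ code for successive refinement with cribbing consists of messages $T_0=f_0(X^n)\in\{1,\dots,2^{nR_0}\}$ and $T_1=f_1(X^n)\in\{1,\dots,2^{nR_1}\}$, a first decoder $\hat X_1^n=g_1(T_0,T_1)$, and a second decoder $\hat X_{2,i}=g_{2,i}\big(T_0,g(\hat X_{1,1}),\dots,g(\hat X_{1,d(i)})\big)$, $i=1,\dots,n$. A $(2^{nR_{12}},2^{nR_1},n)$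 code for cascade source coding with cribbing consists of a message $T_1=f(X^n)\in\{1,\dots,2^{nR_1}\}$ sent to Decoder 1, a message $T_{12}=h(T_1)\in\{1,\dots,2^{nR_{12}}\}$ sent by Decoder 1 to Decoder 2, a first decoder $\hat X_1^n=g_1(T_1)$, and a second decoder $\hat X_{2,i}=g_{2,i}\big(T_{12},g(\hat X_{1,1}),\dots,g(\hat X_{1,d(i)})\big)$, $i=1,\dots,n$. In either setting a rate pair is achievable at $(D_1,D_2)$ if for every $\epsilon>0$ there are $n\ge1$ and a code of block length $n$ with these rates such that $\mathbb E[d_i(X^n,\hat X_i^n)]\le D_i+\epsilon$ for $i=1,2$. Let $\mathcal R(D_1,D_2)$ be the closure of the set of pairs $(R_0,R_1)$ achievable for successive refinement with cribbing, let $\tilde{\mathcal R}(D_1,D_2)$ be the closure of $\{(R_0,R_0+R_1):(R_0,R_1)\in\mathcal R(D_1,D_2)\}$, and let $\mathcal R_{cascade}(D_1,D_2)$ be the closure of the set of pairs $(R_{12},R_1)$ achievable for cascade source coding with cribbing. Then, for each of the three kinds of cribbing and every $(D_1,D_2)\in\mathbb R^2$, the region $\tilde{\mathcal R}(D_1,D_2)$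 equals the cascade region in the range $R_{12}\le R_1$: $$\tilde{\mathcal R}(D_1,D_2)=\mathcal R_{cascade}(D_1,D_2)\cap\{(R_{12},R_1):R_{12}\le R_1\}.$$ -/

import Mathlib

open scoped NNReal

namespace Cribbing

/-- The three kinds of cribbing. -/
inductive Mode where
  | nonCausal
  | strictlyCausal
  | causal

/-- `mode.Observes i j`: before Decoder 2 produces its `i`-th reconstruction symbol, it has seen
the `j`-th crib symbol. All `j` for non-causal cribbing, `j < i` for strictly-causal cribbing,
`j ≤ i` for causal cribbing. -/
def Mode.Observes (mode : Mode) {n : ℕ} (i j : Fin n) : Prop :=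
  match mode with
  | .nonCausal => True
  | .strictlyCausal => j < i
  | .causal => j ≤ i

/-- The number of elements of the message set `{1, …, 2^{nR}}`, that is, of the set of integers
`k` with `1 ≤ k ≤ 2^{nR}`. -/
noncomputable def numMessages (n : ℕ) (R : ℝ) : ℕ := ⌊(2 : ℝ) ^ ((n : ℝ) * R)⌋₊

/-- The probability of the word `x` under `n` independent draws from `P`. -/
noncomputable def wordProb {X : Type*} (P : PMF X) {n : ℕ} (x : Fin n → X) : ℝ :=
  ∏ i, (P (x i)).toReal

/-- The distortion between two words: the average of the single-letter distortions. -/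
noncomputable def wordDistortion {X Y : Type*} (d : X → Y → ℝ≥0) {n : ℕ}
    (x : Fin n → X) (y : Fin n → Y) : ℝ :=
  (1 / (n : ℝ)) * ∑ j, (d (x j) (y j) : ℝ)

/-- The expected distortion between a memoryless source word with letter distribution `P` and its
reconstruction `rec`, the latter being a function of the source word. -/
noncomputable def expectedDistortion {X Y : Type*} [Fintype X] (P : PMF X) (d : X → Y → ℝ≥0)
    {n : ℕ} (rec : (Fin n → X) → Fin n → Y) : ℝ :=
  ∑ x : Fin n → X, wordProb P x * wordDistortion d x (rec x)

/-- The second decoder of either setting: the `i`-th symbol depends on a message from a set of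
size `M` and on the crib symbols that are observed by time `i`. -/
abbrev CribDecoder (mode : Mode) (n M : ℕ) (Z Y₂ : Type*) :=
  (i : Fin n) → Fin M → ({j : Fin n // mode.Observes i j} → Z) → Y₂

/-- A block code of length `n` for successive refinement with cribbing: the message of size `M₀`
goes to both decoders and the message of size `M₁` to Decoder 1 only. -/
structure RefinementCode (X Y₁ Y₂ Z : Type*) (mode : Mode) (n M₀ M₁ : ℕ) where
  enc₀ : (Fin n → X) → Fin M₀
  enc₁ : (Fin n → X) → Fin M₁
  dec₁ : Fin M₀ → Fin M₁ → Fin n → Y₁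
  dec₂ : CribDecoder mode n M₀ Z Y₂

/-- A block code of length `n` for cascade source coding with cribbing: the encoder sends a message
of size `M₁` to Decoder 1 only, and Decoder 1 sends a function of it, of size `M₁₂`, to
Decoder 2. -/
structure CascadeCode (X Y₁ Y₂ Z : Type*) (mode : Mode) (n M₁₂ M₁ : ℕ) where
  enc : (Fin n → X) → Fin M₁
  relay : Fin M₁ → Fin M₁₂
  dec₁ : Fin M₁ → Fin n → Y₁
  dec₂ : CribDecoder mode n M₁₂ Z Y₂

namespace RefinementCode

variable {X Y₁ Y₂ Z : Type*} {mode : Mode} {n M₀ M₁ : ℕ}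

/-- The reconstruction of Decoder 1. -/
def rec₁ (c : RefinementCode X Y₁ Y₂ Z mode n M₀ M₁) (x : Fin n → X) : Fin n → Y₁ :=
  c.dec₁ (c.enc₀ x) (c.enc₁ x)

/-- The reconstruction of Decoder 2, which cribs `g` of the symbols of Decoder 1. -/
def rec₂ (c : RefinementCode X Y₁ Y₂ Z mode n M₀ M₁) (g : Y₁ → Z) (x : Fin n → X) : Fin n → Y₂ :=
  fun i => c.dec₂ i (c.enc₀ x) (fun j => g (c.rec₁ x j))

end RefinementCode

namespace CascadeCode

variable {X Y₁ Y₂ Z : Type*} {mode : Mode} {n M₁₂ M₁ : ℕ}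

/-- The reconstruction of Decoder 1. -/
def rec₁ (c : CascadeCode X Y₁ Y₂ Z mode n M₁₂ M₁) (x : Fin n → X) : Fin n → Y₁ :=
  c.dec₁ (c.enc x)

/-- The reconstruction of Decoder 2, which cribs `g` of the symbols of Decoder 1. -/
def rec₂ (c : CascadeCode X Y₁ Y₂ Z mode n M₁₂ M₁) (g : Y₁ → Z) (x : Fin n → X) : Fin n → Y₂ :=
  fun i => c.dec₂ i (c.relay (c.enc x)) (fun j => g (c.rec₁ x j))

end CascadeCode

section Regions

variable {X Y₁ Y₂ Z : Type*} [Fintype X]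

/-- The rate pair `R = (R₀, R₁)` is achievable for successive refinement with cribbing at the
distortion pair `(D₁, D₂)`. -/
def RefinementAchievable (P : PMF X) (d₁ : X → Y₁ → ℝ≥0) (d₂ : X → Y₂ → ℝ≥0) (g : Y₁ → Z)
    (mode : Mode) (D₁ D₂ : ℝ) (R : ℝ × ℝ) : Prop :=
  0 ≤ R.1 ∧ 0 ≤ R.2 ∧
    ∀ ε : ℝ, 0 < ε → ∃ n : ℕ, 0 < n ∧
      ∃ c : RefinementCode X Y₁ Y₂ Z mode n (numMessages n R.1) (numMessages n R.2),
        expectedDistortion P d₁ c.rec₁ ≤ D₁ + ε ∧ expectedDistortion P d₂ (c.rec₂ g) ≤ D₂ + ε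

/-- The rate pair `R = (R₁₂, R₁)` is achievable for cascade source coding with cribbing at the
distortion pair `(D₁, D₂)`. -/
def CascadeAchievable (P : PMF X) (d₁ : X → Y₁ → ℝ≥0) (d₂ : X → Y₂ → ℝ≥0) (g : Y₁ → Z)
    (mode : Mode) (D₁ D₂ : ℝ) (R : ℝ × ℝ) : Prop :=
  0 ≤ R.1 ∧ 0 ≤ R.2 ∧
    ∀ ε : ℝ, 0 < ε → ∃ n : ℕ, 0 < n ∧
      ∃ c : CascadeCode X Y₁ Y₂ Z mode n (numMessages n R.1) (numMessages n R.2),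
        expectedDistortion P d₁ c.rec₁ ≤ D₁ + ε ∧ expectedDistortion P d₂ (c.rec₂ g) ≤ D₂ + ε

/-- The rate region of successive refinement with cribbing: the closure of the set of achievable
pairs `(R₀, R₁)`. -/
def refinementRegion (P : PMF X) (d₁ : X → Y₁ → ℝ≥0) (d₂ : X → Y₂ → ℝ≥0) (g : Y₁ → Z)
    (mode : Mode) (D₁ D₂ : ℝ) : Set (ℝ × ℝ) :=
  closure {R | RefinementAchievable P d₁ d₂ g mode D₁ D₂ R}

/-- The closure of the set of pairs `(R₀, R₀ + R₁)` with `(R₀, R₁)` in the rate region of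
successive refinement with cribbing. -/
def refinementSumRegion (P : PMF X) (d₁ : X → Y₁ → ℝ≥0) (d₂ : X → Y₂ → ℝ≥0) (g : Y₁ → Z)
    (mode : Mode) (D₁ D₂ : ℝ) : Set (ℝ × ℝ) :=
  closure ((fun R : ℝ × ℝ => (R.1, R.1 + R.2)) '' refinementRegion P d₁ d₂ g mode D₁ D₂)

/-- The rate region of cascade source coding with cribbing: the closure of the set of achievable
pairs `(R₁₂, R₁)`. -/
def cascadeRegion (P : PMF X) (d₁ : X → Y₁ → ℝ≥0) (d₂ : X → Y₂ → ℝ≥0) (g : Y₁ → Z)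
    (mode : Mode) (D₁ D₂ : ℝ) : Set (ℝ × ℝ) :=
  closure {R | CascadeAchievable P d₁ d₂ g mode D₁ D₂ R}

end Regions

end Cribbing

/-! ### Cutting a memoryless source word into blocks. -/

namespace Cribbing

/-! A refinement code becomes a cascade code by sending both messages to Decoder 1, which relays the
first. Conversely, a cascade message must be split into a part that determines the relayed message
and a remainder. The fibers of the relay map may have very unequal sizes, so they are cut into
pieces of size at most `Q ≈ 2^(n(R₁ - R₁₂))`; there are at most about `2 * 2^(n R₁₂)` pieces
(`exists_split`). The factor 2 is absorbed by an arbitrarily small excess rate `δ` once the code has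
been repeated often enough, which leaves the distortions unchanged (`expectedDistortion_blockwise`).
The closures then allow `δ → 0`. -/

/-- The `b`-th of the `k` blocks of length `n` of a word of length `k * n`. -/
def block {X : Type*} {k n : ℕ} (x : Fin (k * n) → X) (b : Fin k) : Fin n → X :=
  fun j => x (finProdFinEquiv (b, j))

/-- A word of length `k * n` is a sequence of `k` blocks of length `n`. -/
def blockEquiv (X : Type*) (k n : ℕ) : (Fin (k * n) → X) ≃ (Fin k → Fin n → X) :=
  (Equiv.arrowCongr finProdFinEquiv.symm (Equiv.refl X)).trans (Equiv.curry _ _ _)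

theorem wordProb_eq_prod_block {X : Type*} (P : PMF X) {k n : ℕ} (x : Fin (k * n) → X) :
    wordProb P x = ∏ b, wordProb P (block x b) := by
  simp only [wordProb, block]
  rw [← finProdFinEquiv.prod_comp, Fintype.prod_prod_type]

section Words

variable {X Y : Type*} [Fintype X]

theorem sum_wordProb (P : PMF X) (n : ℕ) : ∑ x : Fin n → X, wordProb P x = 1 := by
  classical
  have hP : ∑ a, (P a).toReal = 1 := by
    rw [← ENNReal.toReal_sum fun a _ => P.apply_ne_top a, (tsum_fintype P).symm.trans P.tsum_coe,
      ENNReal.toReal_one]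
  have h := Finset.prod_univ_sum (fun _ : Fin n => (Finset.univ : Finset X))
    (fun _ a => (P a).toReal)
  simp only [hP, Finset.prod_const_one, Fintype.piFinset_univ] at h
  exact h.symm

/-- The expectation of a function of one block. -/
theorem sum_wordProb_mul_block (P : PMF X) {k n : ℕ} (b : Fin k) (f : (Fin n → X) → ℝ) :
    ∑ x : Fin (k * n) → X, wordProb P x * f (block x b) = ∑ y, wordProb P y * f y := by
  classical
  -- The factor `f` is attached to block `b` alone; every other block sums to 1 after the product is
  -- expanded.
  have h := Finset.prod_univ_sum (fun _ : Fin k => (Finset.univ : Finset (Fin n → X)))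
    (fun c y => wordProb P y * if c = b then f y else 1)
  have hl : ∏ c : Fin k, ∑ y : Fin n → X, wordProb P y * (if c = b then f y else 1) =
      ∑ y, wordProb P y * f y := by
    rw [Finset.prod_eq_single b]
    · simp
    · intro c _ hc
      simp [hc, sum_wordProb]
    · simp
  rw [hl, Fintype.piFinset_univ] at h
  rw [h, ← (blockEquiv X k n).sum_comp]
  refine Finset.sum_congr rfl fun x _ => ?_
  rw [Finset.prod_mul_distrib, wordProb_eq_prod_block]
  congr 1
  simp only [Finset.prod_ite_eq', Finset.mem_univ, if_true]
  rfl

/-- Applying a reconstruction blockwise does not change the expected distortion. -/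
theorem expectedDistortion_blockwise (P : PMF X) (d : X → Y → ℝ≥0) {k n : ℕ} (hk : 0 < k)
    {r : (Fin n → X) → Fin n → Y} {r' : (Fin (k * n) → X) → Fin (k * n) → Y}
    (h : ∀ x b j, r' x (finProdFinEquiv (b, j)) = r (block x b) j) :
    expectedDistortion P d r' = expectedDistortion P d r := by
  have hd : ∀ x, wordDistortion d x (r' x) =
      (1 / (k : ℝ)) * ∑ b, wordDistortion d (block x b) (r (block x b)) := by
    intro x
    simp only [wordDistortion]
    rw [← finProdFinEquiv.sum_comp, Fintype.sum_prod_type, ← Finset.mul_sum, ← mul_assoc]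
    push_cast
    rw [one_div_mul_one_div]
    simp only [h]
    rfl
  have hk' : (k : ℝ) ≠ 0 := by positivity
  calc expectedDistortion P d r'
      = (1 / (k : ℝ)) * ∑ b : Fin k, ∑ x : Fin (k * n) → X,
          wordProb P x * wordDistortion d (block x b) (r (block x b)) := by
        rw [Finset.sum_comm, Finset.mul_sum]
        refine Finset.sum_congr rfl fun x _ => ?_
        rw [hd, ← Finset.mul_sum]
        ring
    _ = (1 / (k : ℝ)) * ∑ _b : Fin k, expectedDistortion P d r := by
        congr 1
        exact Finset.sum_congr rfl fun b _ =>
          sum_wordProb_mul_block P b fun y => wordDistortion d y (r y)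
    _ = expectedDistortion P d r := by
        simp [hk']

end Words

/-! ### Splitting messages and converting codes. -/

/-- Cutting the fibers of `h` into pieces of size at most `Q` gives at most `|S| / Q + |U|` pieces:
the number of the piece determines `h`, and together with the position in the piece it determines
the point. -/
theorem exists_split {S U : Type*} [Fintype S] [Fintype U] (h : S → U) {N Q : ℕ} (hQ : 0 < Q)
    (hN : Fintype.card S / Q + Fintype.card U ≤ N) :
    ∃ (e₀ : S → Fin N) (e₁ : S → Fin Q), (Function.Injective fun s => (e₀ s, e₁ s)) ∧
      ∀ s t, e₀ s = e₀ t → h s = h t := by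
  classical
  let B : U → ℕ := fun u => Fintype.card {s // h s = u}
  let idx : ∀ u, {s // h s = u} ≃ Fin (B u) := fun u => Fintype.equivFin _
  have hB : ∑ u, B u = Fintype.card S := by
    rw [← Fintype.card_sigma]
    exact Fintype.card_congr (Equiv.sigmaFiberEquiv h)
  -- Each fiber needs at most `B u / Q + 1` pieces; the rounded quotients add up to at most `|S| /
  -- Q`, the ones to `|U|`.
  have hcard : Fintype.card (Σ u, Fin (B u / Q + 1)) ≤ Fintype.card (Fin N) := by
    rw [Fintype.card_sigma, Fintype.card_fin]
    simp only [Fintype.card_fin, Finset.sum_add_distrib]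
    refine le_trans (add_le_add ?_ ?_) hN
    · rw [Nat.le_div_iff_mul_le hQ, ← hB, Finset.sum_mul]
      exact Finset.sum_le_sum fun u _ => Nat.div_mul_le_self _ _
    · simp
  obtain ⟨ι⟩ := Function.Embedding.nonempty_of_card_le hcard
  let pos : S → ℕ := fun s => idx (h s) ⟨s, rfl⟩
  have hpos : ∀ s t, h s = h t → pos s = pos t → s = t := by
    intro s t hst hp
    have key : ∀ u (hs : h s = u) (ht : h t = u),
        (idx u ⟨s, hs⟩ : ℕ) = idx u ⟨t, ht⟩ → s = t := fun u hs ht e =>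
      congrArg Subtype.val ((idx u).injective (Fin.ext e))
    refine key (h t) hst rfl ?_
    rw [← show pos t = idx (h t) ⟨t, rfl⟩ from rfl, ← hp]
    have : ∀ u (hs : h s = u), (idx u ⟨s, hs⟩ : ℕ) = pos s := by
      rintro u rfl
      rfl
    exact this _ _
  let chunk : S → Σ u, Fin (B u / Q + 1) := fun s =>
    ⟨h s, pos s / Q, Nat.lt_succ_of_le (Nat.div_le_div_right (Fin.is_lt _).le)⟩
  have hchunk : ∀ s t, chunk s = chunk t → h s = h t ∧ pos s / Q = pos t / Q := by
    intro s t hst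
    exact ⟨congrArg Sigma.fst hst,
      congrArg (fun p : Σ u, Fin (B u / Q + 1) => (p.2 : ℕ)) hst⟩
  refine ⟨fun s => ι (chunk s), fun s => ⟨pos s % Q, Nat.mod_lt _ hQ⟩, ?_, ?_⟩
  · intro s t hst
    obtain ⟨h₀, h₁⟩ := Prod.mk.inj hst
    obtain ⟨hh, hq⟩ := hchunk s t (ι.injective h₀)
    refine hpos s t hh ?_
    rw [← Nat.div_add_mod (pos s) Q, ← Nat.div_add_mod (pos t) Q, hq, Fin.mk.inj h₁]
  · exact fun s t hst => (hchunk s t (ι.injective hst)).1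

/-- Time order within a block is preserved by the shift, so the cribs needed in a block are
available in the long word. -/
theorem Mode.observes_block (mode : Mode) {k n : ℕ} (b : Fin k) {i j : Fin n}
    (h : mode.Observes i j) :
    mode.Observes (finProdFinEquiv (b, i)) (finProdFinEquiv (b, j)) := by
  cases mode
  · trivial
  · have h : (j : ℕ) < i := h
    have : (j : ℕ) + n * b < i + n * b := by omega
    exact this
  · have h : (j : ℕ) ≤ i := h
    have : (j : ℕ) + n * b ≤ i + n * b := by omega
    exact this

section Codes

variable {X Y₁ Y₂ Z : Type*} {mode : Mode}

/-- The messages of a refinement code, sent together to Decoder 1 of a cascade. -/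
theorem RefinementCode.exists_cascadeCode [Nonempty X] {n M₀ M₁ M : ℕ}
    (c : RefinementCode X Y₁ Y₂ Z mode n M₀ M₁) (hM : M₀ * M₁ ≤ M) :
    ∃ c' : CascadeCode X Y₁ Y₂ Z mode n M₀ M, c'.rec₁ = c.rec₁ ∧ ∀ g, c'.rec₂ g = c.rec₂ g := by
  classical
  -- Supplies irrelevant values for messages outside the range of `ι`.
  have x₀ : Fin n → X := fun _ => Classical.arbitrary X
  obtain ⟨ι⟩ : Nonempty (Fin M₀ × Fin M₁ ↪ Fin M) :=
    Function.Embedding.nonempty_of_card_le (by simpa using hM)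
  have hfst : ∀ p, Function.extend ι Prod.fst (fun _ => c.enc₀ x₀) (ι p) = p.1 := fun p =>
    ι.injective.extend_apply _ _ _
  have hdec : ∀ p, Function.extend ι (fun p => c.dec₁ p.1 p.2) (fun _ => c.rec₁ x₀) (ι p) =
      c.dec₁ p.1 p.2 := fun p => ι.injective.extend_apply _ _ _
  have h₁ : ∀ x, Function.extend ι (fun p => c.dec₁ p.1 p.2) (fun _ => c.rec₁ x₀)
      (ι (c.enc₀ x, c.enc₁ x)) = c.rec₁ x := fun x => hdec _
  refine ⟨⟨fun x => ι (c.enc₀ x, c.enc₁ x), Function.extend ι Prod.fst fun _ => c.enc₀ x₀,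
    Function.extend ι (fun p => c.dec₁ p.1 p.2) fun _ => c.rec₁ x₀, c.dec₂⟩, funext h₁, ?_⟩
  intro g
  funext x i
  simp only [CascadeCode.rec₂, CascadeCode.rec₁, RefinementCode.rec₂, hfst, h₁]

/-- A cascade code used `k` times in a row, with the fibers of the relay map cut into pieces of
size `Q`. -/
theorem CascadeCode.exists_refinementCode [Nonempty X] {n M₁₂ M₁ N Q : ℕ}
    (c : CascadeCode X Y₁ Y₂ Z mode n M₁₂ M₁) (k : ℕ) (hQ : 0 < Q)
    (hN : M₁ ^ k / Q + M₁₂ ^ k ≤ N) :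
    ∃ c' : RefinementCode X Y₁ Y₂ Z mode (k * n) N Q,
      (∀ x b j, c'.rec₁ x (finProdFinEquiv (b, j)) = c.rec₁ (block x b) j) ∧
      ∀ g x b j, c'.rec₂ g x (finProdFinEquiv (b, j)) = c.rec₂ g (block x b) j := by
  classical
  have m₀ : Fin M₁ := c.enc fun _ => Classical.arbitrary X
  obtain ⟨e₀, e₁, hinj, hfac⟩ := exists_split (fun (s : Fin k → Fin M₁) b => c.relay (s b))
    (N := N) hQ (by simpa using hN)
  let D₀ : Fin N → Fin k → Fin M₁₂ :=
    Function.extend e₀ (fun s b => c.relay (s b)) fun _ _ => c.relay m₀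
  -- `e₀` need not be injective, but the relayed word is constant on its fibers.
  have hD₀ : ∀ s, D₀ (e₀ s) = fun b => c.relay (s b) := fun s =>
    Function.FactorsThrough.extend_apply (fun s t => hfac s t) _ s
  let D₁ : Fin N × Fin Q → Fin k → Fin M₁ :=
    Function.extend (fun s => (e₀ s, e₁ s)) id fun _ _ => m₀
  have hD₁ : ∀ s, D₁ (e₀ s, e₁ s) = s := fun s => hinj.extend_apply _ _ s
  let w : (Fin (k * n) → X) → Fin k → Fin M₁ := fun x b => c.enc (block x b)
  let c' : RefinementCode X Y₁ Y₂ Z mode (k * n) N Q :=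
    { enc₀ := fun x => e₀ (w x)
      enc₁ := fun x => e₁ (w x)
      dec₁ := fun t₀ t₁ i => c.dec₁ (D₁ (t₀, t₁) (finProdFinEquiv.symm i).1)
        (finProdFinEquiv.symm i).2
      dec₂ := fun i t₀ z => c.dec₂ (finProdFinEquiv.symm i).2 (D₀ t₀ (finProdFinEquiv.symm i).1)
        fun j => z ⟨finProdFinEquiv ((finProdFinEquiv.symm i).1, j.1), by
          have := mode.observes_block (finProdFinEquiv.symm i).1 j.2
          rwa [Prod.mk.eta, Equiv.apply_symm_apply] at this⟩ }
  have h₁ : ∀ x b j, c'.rec₁ x (finProdFinEquiv (b, j)) = c.rec₁ (block x b) j := by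
    intro x b j
    simp only [RefinementCode.rec₁, CascadeCode.rec₁, c', hD₁, Equiv.symm_apply_apply, w]
  refine ⟨c', h₁, ?_⟩
  intro g x b j
  -- The decoded index is generalized to `p` because the type of the observed crib symbols depends
  -- on it.
  have h₂ : ∀ p : Fin k × Fin n, finProdFinEquiv.symm (finProdFinEquiv (b, j)) = p →
      c'.rec₂ g x (finProdFinEquiv (b, j)) =
        c.dec₂ p.2 (c.relay (w x p.1)) fun i => g (c.rec₁ (block x p.1) i) := by
    rintro p rfl
    simp only [RefinementCode.rec₂, c', hD₀]
    congr 1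
    funext i
    exact congrArg g (h₁ x _ _)
  exact h₂ (b, j) (Equiv.symm_apply_apply _ _)

end Codes

/-! ### Rates and rounding. -/

theorem numMessages_le {n : ℕ} {R : ℝ} : (numMessages n R : ℝ) ≤ 2 ^ ((n : ℝ) * R) :=
  Nat.floor_le (by positivity)

theorem numMessages_mul_le (n : ℕ) (R R' : ℝ) :
    numMessages n R * numMessages n R' ≤ numMessages n (R + R') := by
  refine Nat.le_floor ?_
  rw [mul_add, Real.rpow_add two_pos]
  push_cast
  exact mul_le_mul numMessages_le numMessages_le (by positivity) (by positivity)

theorem numMessages_pow_le (n k : ℕ) (R : ℝ) :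
    (numMessages n R : ℝ) ^ k ≤ 2 ^ (((k * n : ℕ) : ℝ) * R) := by
  calc (numMessages n R : ℝ) ^ k ≤ ((2 : ℝ) ^ ((n : ℝ) * R)) ^ k :=
        pow_le_pow_left₀ (by positivity) numMessages_le k
    _ = 2 ^ (((k * n : ℕ) : ℝ) * R) := by
        rw [← Real.rpow_mul_natCast two_pos.le]
        push_cast
        ring_nf

/-- A small excess in rate doubles the size of the message set. -/
theorem two_mul_rpow_le {n : ℕ} {R δ : ℝ} (h : 1 ≤ n * δ) :
    2 * (2 : ℝ) ^ ((n : ℝ) * R) ≤ 2 ^ ((n : ℝ) * (R + δ)) := by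
  calc 2 * (2 : ℝ) ^ ((n : ℝ) * R) = 2 ^ (1 + (n : ℝ) * R) := by
        rw [Real.rpow_add two_pos, Real.rpow_one]
    _ ≤ _ := Real.rpow_le_rpow_of_exponent_le one_le_two (by linarith)

/-- Rounding down loses less than 1, and `2^(nR) ≥ 1`, so doubling the bound pays for the rounding.
-/
theorem rpow_le_numMessages {n : ℕ} {R δ : ℝ} (hR : 0 ≤ R) (h : 1 ≤ n * δ) :
    (2 : ℝ) ^ ((n : ℝ) * R) ≤ numMessages n (R + δ) := by
  have h₁ : (1 : ℝ) ≤ 2 ^ ((n : ℝ) * R) := Real.one_le_rpow one_le_two (by positivity)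
  have h₂ := Nat.lt_floor_add_one ((2 : ℝ) ^ ((n : ℝ) * (R + δ)))
  have h₃ := two_mul_rpow_le (R := R) h
  rw [numMessages]
  linarith

/-! ### Comparing the regions. -/

section Regions

variable {X Y₁ Y₂ Z : Type*} [Fintype X] {P : PMF X} {d₁ : X → Y₁ → ℝ≥0} {d₂ : X → Y₂ → ℝ≥0}
  {g : Y₁ → Z} {mode : Mode} {D₁ D₂ : ℝ}

theorem RefinementAchievable.cascadeAchievable {R : ℝ × ℝ}
    (h : RefinementAchievable P d₁ d₂ g mode D₁ D₂ R) :
    CascadeAchievable P d₁ d₂ g mode D₁ D₂ (R.1, R.1 + R.2) := by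
  have : Nonempty X := P.support_nonempty.to_type
  obtain ⟨h₀, h₁, h⟩ := h
  refine ⟨h₀, add_nonneg h₀ h₁, fun ε hε => ?_⟩
  obtain ⟨n, hn, c, hc₁, hc₂⟩ := h ε hε
  obtain ⟨c', h₁, h₂⟩ := c.exists_cascadeCode (numMessages_mul_le n R.1 R.2)
  exact ⟨n, hn, c', by rwa [h₁], by rwa [h₂]⟩

theorem CascadeAchievable.refinementAchievable {a b : ℝ}
    (h : CascadeAchievable P d₁ d₂ g mode D₁ D₂ (a, b)) {δ : ℝ} (hδ : 0 < δ) :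
    RefinementAchievable P d₁ d₂ g mode D₁ D₂ (a + δ, max a b - a + δ) := by
  have : Nonempty X := P.support_nonempty.to_type
  obtain ⟨ha, -, h⟩ := h
  have hab : 0 ≤ max a b - a := sub_nonneg.2 (le_max_left _ _)
  refine ⟨add_nonneg ha hδ.le, add_nonneg hab hδ.le, fun ε hε => ?_⟩
  obtain ⟨n, hn, c, hc₁, hc₂⟩ := h ε hε
  -- The block length `n` is dictated by `ε` and may be small; repetition makes it long enough for
  -- `δ`.
  obtain ⟨k, hk⟩ := exists_nat_ge (1 / δ)
  have hk₀ : 0 < k := by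
    have : (0 : ℝ) < k := lt_of_lt_of_le (by positivity) hk
    exact_mod_cast this
  have hkn : 1 ≤ ((k * n : ℕ) : ℝ) * δ := by
    have h₁ : 1 ≤ k * δ := (div_le_iff₀ hδ).1 hk
    have h₂ : (1 : ℝ) ≤ n := by exact_mod_cast hn
    push_cast
    nlinarith
  have hQ : (2 : ℝ) ^ (((k * n : ℕ) : ℝ) * (max a b - a)) ≤
      numMessages (k * n) (max a b - a + δ) := rpow_le_numMessages hab hkn
  have hQ₀ : (0 : ℝ) < numMessages (k * n) (max a b - a + δ) :=
    lt_of_lt_of_le (by positivity) hQ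
  have hsize : numMessages n b ^ k / numMessages (k * n) (max a b - a + δ) +
      numMessages n a ^ k ≤ numMessages (k * n) (a + δ) := by
    refine Nat.le_floor ?_
    have h₁ : ((numMessages n b ^ k / numMessages (k * n) (max a b - a + δ) : ℕ) : ℝ) ≤
        2 ^ (((k * n : ℕ) : ℝ) * a) := by
      refine Nat.cast_div_le.trans ((div_le_iff₀ hQ₀).2 ?_)
      rw [Nat.cast_pow]
      calc (numMessages n b : ℝ) ^ k ≤ 2 ^ (((k * n : ℕ) : ℝ) * b) := numMessages_pow_le n k b
        _ ≤ 2 ^ (((k * n : ℕ) : ℝ) * max a b) :=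
          Real.rpow_le_rpow_of_exponent_le one_le_two
            (mul_le_mul_of_nonneg_left (le_max_right _ _) (Nat.cast_nonneg _))
        _ = 2 ^ (((k * n : ℕ) : ℝ) * a) * 2 ^ (((k * n : ℕ) : ℝ) * (max a b - a)) := by
          rw [← Real.rpow_add two_pos]
          ring_nf
        _ ≤ _ := mul_le_mul_of_nonneg_left (by exact_mod_cast hQ) (by positivity)
    have h₂ := numMessages_pow_le n k a
    have h₃ := two_mul_rpow_le (R := a) hkn
    rw [Nat.cast_add, Nat.cast_pow]
    linarith
  obtain ⟨c', h₁, h₂⟩ := c.exists_refinementCode k (by exact_mod_cast hQ₀) hsize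
  exact ⟨k * n, Nat.mul_pos hk₀ hn, c',
    (expectedDistortion_blockwise P d₁ hk₀ h₁).trans_le hc₁,
    (expectedDistortion_blockwise P d₂ hk₀ (h₂ g)).trans_le hc₂⟩

theorem CascadeAchievable.mem_refinementSumRegion {R : ℝ × ℝ}
    (h : CascadeAchievable P d₁ d₂ g mode D₁ D₂ R) :
    (R.1, max R.1 R.2) ∈ refinementSumRegion P d₁ d₂ g mode D₁ D₂ := by
  have hlim : Filter.Tendsto (fun δ : ℝ => (R.1 + δ, R.1 + δ + (max R.1 R.2 - R.1 + δ)))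
      (nhdsWithin 0 (Set.Ioi 0)) (nhds (R.1, max R.1 R.2)) := by
    have hc : Continuous fun δ : ℝ => (R.1 + δ, R.1 + δ + (max R.1 R.2 - R.1 + δ)) := by fun_prop
    simpa using (hc.tendsto 0).mono_left nhdsWithin_le_nhds
  refine mem_closure_of_tendsto hlim ?_
  filter_upwards [self_mem_nhdsWithin] with δ hδ
  exact ⟨_, subset_closure (h.refinementAchievable hδ), rfl⟩

end Regions

end Cribbing

theorem lemma1 {X Y₁ Y₂ Z : Type*} [Fintype X] [Fintype Y₁] [Fintype Y₂] [Fintype Z]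
    (P : PMF X) (d₁ : X → Y₁ → ℝ≥0) (d₂ : X → Y₂ → ℝ≥0) (g : Y₁ → Z)
    (mode : Cribbing.Mode) (D₁ D₂ : ℝ) :
    Cribbing.refinementSumRegion P d₁ d₂ g mode D₁ D₂ =
      Cribbing.cascadeRegion P d₁ d₂ g mode D₁ D₂ ∩ {R : ℝ × ℝ | R.1 ≤ R.2} := by
  apply Set.Subset.antisymm
  · refine closure_minimal (((image_closure_subset_closure_image (by fun_prop)).trans
      (closure_minimal ?_ ?_))) ?_
    · rintro _ ⟨R, hR, rfl⟩
      exact ⟨subset_closure hR.cascadeAchievable, le_add_of_nonneg_right hR.2.1⟩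
    all_goals exact isClosed_closure.inter (isClosed_le continuous_fst continuous_snd)
  · rintro ⟨a, b⟩ ⟨hR, hab : a ≤ b⟩
    -- A point with `a ≤ b` may be a limit of achievable pairs violating this inequality. The map to
    -- `(R.1, max R.1 R.2)` corrects these pairs and fixes the limit.
    have hc : Continuous fun R : ℝ × ℝ => (R.1, max R.1 R.2) := by fun_prop
    have h := map_mem_closure hc hR fun R hR =>
      Cribbing.CascadeAchievable.mem_refinementSumRegion hR
    rw [Cribbing.refinementSumRegion, closure_closure] at h
    simpa [Cribbing.refinementSumRegion, max_eq_right hab] using h
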